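/- Let $d\ge 2$, let $\mathbb{B}^d=\{x\in\mathbb{R}^d:\|x\|\le 1\}$ be the Euclidean unit ball, and let $\kappa_k$ denote the volume of the unit ball of $\mathbb{R}^k$. For $j\in\{1,\ldots,d-1\}$ let $G(d,j)$ be the Grassmannian of $j$-dimensional linear subspaces of $\mathbb{R}^d$ with its rotation invariant (Haar) probability measure $\nu_j$. For a compact convex set $K\subset\mathbb{R}^d$ with non-empty interior, let $$V_j(K)=\binom dj\frac{\kappa_d}{\kappa_j\kappa_{d-j}}\int_{G(d,j)}\mathrm{vol}_j(K|M)\,\nu_j(\mathrm{d}M)$$ be its $j$-th intrinsic volume, where $K|M$ is the orthogonal projection of $K$ onto $M$. For $x\neq 0$ let $L(x)$ be the line through $0$ and $x$, let $G(L(x),j)$ be the set of all $j$-dimensional linear subspaces of $\mathbb{R}^d$ that contain $L(x)$, let $\nu_j^{L(x)}$ be the Haar probability measure on it (the one that is invariant under all orthogonal maps preserving $L(x)$), and put $$\theta_j(x)=\nu_j^{L(x)}\big(\{M\in G(L(x),j): x\notin K|M\}\big).$$ **Lemma.** Let $K\subset\mathbb{B}^d$ be a compact convex set with non-empty interior, and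 let $j\in\{1,\ldots,d-1\}$. Then $x\mapsto\theta_j(x)\,\|x\|^{-(d-j)}$ is integrable over $\mathbb{B}^d\setminus K$, and $$V_j(\mathbb{B}^d)-V_j(K)=\frac{\binom{d-1}{j-1}}{\kappa_{d-j}}\int_{\mathbb{B}^d\setminus K}\theta_j(x)\,\|x\|^{-(d-j)}\,\mathrm{d}x .$$ -/

import Mathlib

open MeasureTheory
open scoped Pointwise

noncomputable section

/-- Euclidean space `ℝᵈ`. -/
abbrev Euc (d : ℕ) : Type := EuclideanSpace ℝ (Fin d)

/-- The orthogonal group `O(d)`, as the group of unitary elements of the algebra of linear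
operators of `ℝᵈ`, with the operator norm topology and its Borel sets. It acts on the linear
subspaces of `ℝᵈ` by `g • L = g(L)`. -/
abbrev OrthGroup (d : ℕ) : Type := unitary (Euc d →L[ℝ] Euc d)

/-- The subgroup of those `g ∈ O(d)` that satisfy `g(L) = L`. -/
abbrev orthStabilizer {d : ℕ} (L : Submodule ℝ (Euc d)) : Subgroup (OrthGroup d) :=
  MulAction.stabilizer (OrthGroup d) L

instance continuousStar_euc (d : ℕ) : ContinuousStar (Euc d →L[ℝ] Euc d) where
  continuous_star := (ContinuousLinearMap.adjoint (𝕜 := ℝ) (E := Euc d) (F := Euc d)).continuous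

theorem OrthGroup.norm_apply {d : ℕ} (g : OrthGroup d) (x : Euc d) :
    ‖(g : Euc d →L[ℝ] Euc d) x‖ = ‖x‖ :=
  (Unitary.linearIsometryEquiv g).norm_map x

theorem OrthGroup.injective {d : ℕ} (g : OrthGroup d) :
    Function.Injective ((g : Euc d →L[ℝ] Euc d) : Euc d →ₗ[ℝ] Euc d) :=
  (Unitary.linearIsometryEquiv g).injective

instance OrthGroup.compactSpace (d : ℕ) : CompactSpace (OrthGroup d) := by
  refine isCompact_iff_compactSpace.mp ?_
  refine Metric.isCompact_of_isClosed_isBounded isClosed_unitary ?_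
  refine (Metric.isBounded_closedBall (x := (0 : Euc d →L[ℝ] Euc d)) (r := 1)).subset ?_
  intro g hg
  rw [mem_closedBall_zero_iff]
  exact ContinuousLinearMap.opNorm_le_bound _ zero_le_one fun x => by
    rw [one_mul]; exact (OrthGroup.norm_apply ⟨g, hg⟩ x).le

theorem OrthGroup.finrank_smul {d : ℕ} (g : OrthGroup d) (M : Submodule ℝ (Euc d)) :
    Module.finrank ℝ (g • M : Submodule ℝ (Euc d)) = Module.finrank ℝ M :=
  (Submodule.equivMapOfInjective _ g.injective M).finrank_eq.symm

theorem OrthGroup.smul_eq_iff {d : ℕ} (g : OrthGroup d) (L : Submodule ℝ (Euc d)) :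
    g • L = L ↔ ∀ x ∈ L, (g : Euc d →L[ℝ] Euc d) x ∈ L := by
  constructor
  · intro h x hx
    rw [← h]
    exact Submodule.mem_map_of_mem hx
  · intro h
    refine Submodule.eq_of_le_of_finrank_eq ?_ (g.finrank_smul L)
    rintro _ ⟨x, hx, rfl⟩
    exact h x hx

instance orthStabilizer.compactSpace {d : ℕ} (L : Submodule ℝ (Euc d)) :
    CompactSpace (orthStabilizer L) := by
  refine isCompact_iff_compactSpace.mp (IsClosed.isCompact ?_)
  have h : ((orthStabilizer L : Subgroup (OrthGroup d)) : Set (OrthGroup d)) =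
      ⋂ x ∈ L, (fun g : OrthGroup d => (g : Euc d →L[ℝ] Euc d) x) ⁻¹' (L : Set (Euc d)) := by
    ext g
    simp only [SetLike.mem_coe, MulAction.mem_stabilizer_iff, OrthGroup.smul_eq_iff,
      Set.mem_iInter, Set.mem_preimage]
  rw [h]
  refine isClosed_biInter fun x _ => IsClosed.preimage ?_ L.closed_of_finiteDimensional
  exact (ContinuousLinearMap.apply ℝ (Euc d) x).continuous.comp continuous_subtype_val

/-- `G(L, j)`: the set of all `j`-dimensional linear subspaces of `ℝᵈ` that contain `L`. -/
structure GrassOver {d : ℕ} (L : Submodule ℝ (Euc d)) (j : ℕ) : Type where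
  /-- the underlying linear subspace -/
  space : Submodule ℝ (Euc d)
  finrank_eq : Module.finrank ℝ space = j
  le_space : L ≤ space

/-- `G(d, j)`: the Grassmannian of all `j`-dimensional linear subspaces of `ℝᵈ`. -/
abbrev Grass (d j : ℕ) : Type := GrassOver (⊥ : Submodule ℝ (Euc d)) j

/-- The Borel `σ`-algebra of `G(L, j)`, for the usual topology, in which `M` depends continuously
on a parameter if and only if the orthogonal projection onto `M` does. -/
instance GrassOver.measurableSpace {d : ℕ} (L : Submodule ℝ (Euc d)) (j : ℕ) :
    MeasurableSpace (GrassOver L j) :=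
  MeasurableSpace.comap (fun M => (M.space.starProjection : Euc d →L[ℝ] Euc d)) inferInstance

/-- The action `M ↦ g(M)` on `G(L, j)` of the group of all `g ∈ O(d)` with `g(L) = L`. -/
def GrassOver.rotate {d : ℕ} {L : Submodule ℝ (Euc d)} {j : ℕ}
    (g : orthStabilizer L) (M : GrassOver L j) : GrassOver L j :=
  ⟨(g : OrthGroup d) • M.space, (OrthGroup.finrank_smul _ _).trans M.finrank_eq,
    (show (g : OrthGroup d) • L = L from g.2).ge.trans (Submodule.map_mono M.le_space)⟩

open Classical in
/-- The Haar probability measure `ν_j^L` on `G(L, j)`: the image of the Haar probability measure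
of the compact group `{g ∈ O(d) : g(L) = L}` under `g ↦ g(M₀)`, where `M₀` is any element of
`G(L, j)`. As this group acts transitively, `M₀` is immaterial, and the result is the only
probability measure on `G(L, j)` that is invariant under the group. -/
def grassHaar {d : ℕ} (L : Submodule ℝ (Euc d)) (j : ℕ) : Measure (GrassOver L j) :=
  if h : Nonempty (GrassOver L j) then
    (Measure.haarMeasure (⊤ : TopologicalSpace.PositiveCompacts (orthStabilizer L))).map
      (fun g => GrassOver.rotate g h.some)
  else 0

/-- `κ_k`: the volume of the unit ball of `ℝᵏ`. -/
def kappa (k : ℕ) : ℝ :=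
  (volume : Measure (Euc k)).real (Metric.closedBall 0 1)

/-- The `j`-volume of the orthogonal projection `K|M` of `K` onto `M`, where `j = dim M`; `M` carries
the Lebesgue measure of the Euclidean structure that it inherits from `ℝᵈ`. -/
def projVolume {d : ℕ} (K : Set (Euc d)) (M : Submodule ℝ (Euc d)) : ℝ :=
  (volume : Measure M).real (M.orthogonalProjectionOnto '' K)

/-- The `j`-th intrinsic volume `V_j(K)` of a convex body `K` in `ℝᵈ`. -/
def intrinsicVolume {d : ℕ} (j : ℕ) (K : Set (Euc d)) : ℝ :=
  (d.choose j : ℝ) * (kappa d / (kappa j * kappa (d - j))) *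
    ∫ M : Grass d j, projVolume K M.space ∂(grassHaar (⊥ : Submodule ℝ (Euc d)) j)

/-- `θ_j(x)` for `x ≠ 0`: the `ν_j^{L(x)}`-measure of the set of all `M ∈ G(L(x), j)` such that `x`
does not belong to the orthogonal projection `K|M`, where `L(x)` is the line through `0` and `x`. -/
def theta {d : ℕ} (j : ℕ) (K : Set (Euc d)) (x : Euc d) : ℝ :=
  (grassHaar (Submodule.span ℝ {x}) j).real {M | x ∉ M.space.starProjection '' K}

end

/-! Let F(x, P) indicate that ‖x‖ ≤ 1 and x ∉ P(K). For a j-dimensional N, vol_j(𝔹|N) − vol_j(K|N)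
is the integral of F(y, P_N) over y ∈ N, while for x in the ball θ_j(x) is the average of F(x, P_N)
over the N through x. The claim is thus a Blaschke–Petkantschin formula: a random N followed by a
point of N amounts, up to a constant, to a point x weighted by ‖x‖^{-(d-j)} followed by a random N
through x.

Fix a j-dimensional M with a unit vector e, and let R(r) be the average of F(g(re), gM) over g ∈
O(d). Maps preserving M act transitively on the spheres of M, so Fubini turns the first side into
∫_M R(‖y‖) dy (`lintegral_lintegral_smul`). Rotation invariance of Lebesgue measure turns the second
into ∫ ‖x‖^{-(d-j)} R(‖x‖) dx (`lintegral_mul_lineAverage`, resting on `lintegral_lineAverage`).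
Polar coordinates in M and in ℝᵈ reduce both to the same radial integral (`integral_zpow_mul_norm`),
and d·C(d-1, j-1) = j·C(d, j) settles the constant (`choose_mul_kappa`). -/

noncomputable section

/-! ### Orthogonal maps acting on subspaces -/

section OrthogonalMaps

variable {d : ℕ}

@[simp]
theorem OrthGroup.mul_apply (g h : OrthGroup d) (x : Euc d) :
    ((g * h : OrthGroup d) : Euc d →L[ℝ] Euc d) x =
      (g : Euc d →L[ℝ] Euc d) ((h : Euc d →L[ℝ] Euc d) x) := rfl

@[simp]
theorem OrthGroup.one_apply (x : Euc d) :
    ((1 : OrthGroup d) : Euc d →L[ℝ] Euc d) x = x := rfl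

theorem OrthGroup.inv_apply_self (g : OrthGroup d) (x : Euc d) :
    ((g⁻¹ : OrthGroup d) : Euc d →L[ℝ] Euc d) ((g : Euc d →L[ℝ] Euc d) x) = x := by
  rw [← OrthGroup.mul_apply, inv_mul_cancel, OrthGroup.one_apply]

theorem OrthGroup.self_apply_inv (g : OrthGroup d) (x : Euc d) :
    (g : Euc d →L[ℝ] Euc d) (((g⁻¹ : OrthGroup d) : Euc d →L[ℝ] Euc d) x) = x := by
  rw [← OrthGroup.mul_apply, mul_inv_cancel, OrthGroup.one_apply]

theorem OrthGroup.apply_mem_smul (g : OrthGroup d) {M : Submodule ℝ (Euc d)} {x : Euc d}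
    (hx : x ∈ M) : (g : Euc d →L[ℝ] Euc d) x ∈ g • M :=
  Submodule.mem_map_of_mem hx

theorem OrthGroup.mul_smul (g h : OrthGroup d) (M : Submodule ℝ (Euc d)) :
    (g * h) • M = g • h • M :=
  SemigroupAction.mul_smul g h M

theorem OrthGroup.smul_span_singleton (g : OrthGroup d) (x : Euc d) :
    g • (Submodule.span ℝ {x}) = Submodule.span ℝ {(g : Euc d →L[ℝ] Euc d) x} :=
  (Submodule.map_span _ _).trans (by rw [Set.image_singleton]; rfl)

/-- A reflection interchanging two vectors of equal norm preserves every subspace containing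
both. -/
theorem OrthGroup.exists_apply_eq {v w : Euc d} (h : ‖v‖ = ‖w‖) :
    ∃ g : OrthGroup d, (g : Euc d →L[ℝ] Euc d) v = w ∧
      ∀ M : Submodule ℝ (Euc d), v ∈ M → w ∈ M → g • M = M := by
  refine ⟨Unitary.linearIsometryEquiv.symm (Submodule.reflection (ℝ ∙ (v - w))ᗮ), ?_, ?_⟩
  · exact Submodule.reflection_sub h
  · intro M hv hw
    rw [OrthGroup.smul_eq_iff]
    intro x hx
    change Submodule.reflection (ℝ ∙ (v - w))ᗮ x ∈ M
    rw [Submodule.reflection_orthogonal_apply, Submodule.reflection_apply]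
    refine M.neg_mem (M.sub_mem (M.nsmul_mem ?_ 2) hx)
    have : (ℝ ∙ (v - w)) ≤ M := by
      rw [Submodule.span_singleton_le_iff_mem]; exact M.sub_mem hv hw
    exact this (Submodule.starProjection_apply_mem _ _)

/-- Extend an isometry M → N to ℝᵈ. It may move x, but x and its image are vectors of N of equal
norm, so a reflection preserving N moves the image back to x. -/
theorem OrthGroup.exists_smul_eq {M N : Submodule ℝ (Euc d)}
    (h : Module.finrank ℝ M = Module.finrank ℝ N) {x : Euc d} (hM : x ∈ M) (hN : x ∈ N) :
    ∃ g : OrthGroup d, (g : Euc d →L[ℝ] Euc d) x = x ∧ g • M = N := by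
  have e : M ≃ₗᵢ[ℝ] N := ((stdOrthonormalBasis ℝ M).reindex (finCongr h)).equiv
    (stdOrthonormalBasis ℝ N) (Equiv.refl _)
  let φ : M →ₗᵢ[ℝ] Euc d := N.subtypeₗᵢ.comp e.toLinearIsometry
  let g₁ : OrthGroup d := Unitary.linearIsometryEquiv.symm
    (φ.extend.toLinearIsometryEquiv rfl)
  have hg₁ : ∀ y : M, (g₁ : Euc d →L[ℝ] Euc d) y = e y := fun y => φ.extend_apply y
  have hg₁M : g₁ • M = N := by
    refine Submodule.eq_of_le_of_finrank_eq ?_ ((g₁.finrank_smul M).trans h)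
    rintro _ ⟨y, hy, rfl⟩
    change (g₁ : Euc d →L[ℝ] Euc d) y ∈ N
    have := hg₁ ⟨y, hy⟩
    simp only at this
    rw [this]; exact (e _).2
  obtain ⟨ρ, hρ, hρN⟩ := OrthGroup.exists_apply_eq (v := (g₁ : Euc d →L[ℝ] Euc d) x) (w := x)
    (g₁.norm_apply x)
  refine ⟨ρ * g₁, hρ, ?_⟩
  rw [OrthGroup.mul_smul, hg₁M]
  exact hρN N (hg₁M ▸ g₁.apply_mem_smul hM) hN

theorem OrthGroup.starProjection_smul (g : OrthGroup d) (M : Submodule ℝ (Euc d)) :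
    (g • M).starProjection =
      (g : Euc d →L[ℝ] Euc d) * M.starProjection * star (g : Euc d →L[ℝ] Euc d) := by
  ext1 x
  exact Submodule.starProjection_map_apply (Unitary.linearIsometryEquiv g) M x

theorem OrthGroup.smul_mul_starProjection (g h : OrthGroup d) (M : Submodule ℝ (Euc d))
    (hM : h • M = M) : ((g * h) • M).starProjection = (g • M).starProjection := by
  rw [OrthGroup.mul_smul, hM]

instance Euc.secondCountable_clm : SecondCountableTopology (Euc d →L[ℝ] Euc d) :=
  haveI := FiniteDimensional.proper ℝ (Euc d →L[ℝ] Euc d)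
  inferInstance

instance OrthGroup.polishSpace : PolishSpace (OrthGroup d) :=
  (isClosed_unitary (R := Euc d →L[ℝ] Euc d)).polishSpace

theorem OrthGroup.continuous_starProjection_smul (M : Submodule ℝ (Euc d)) :
    Continuous fun g : OrthGroup d => (g • M).starProjection := by
  simp only [OrthGroup.starProjection_smul]
  fun_prop

theorem OrthGroup.continuous_apply :
    Continuous fun p : OrthGroup d × Euc d => (p.1 : Euc d →L[ℝ] Euc d) p.2 := by
  fun_prop

end OrthogonalMaps

/-! ### Haar probability measures of compact groups -/

section HaarProbability

/-- Haar probability measure of a compact group. -/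
abbrev haarProb (G : Type*) [Group G] [TopologicalSpace G] [IsTopologicalGroup G]
    [CompactSpace G] [MeasurableSpace G] [BorelSpace G] : Measure G :=
  Measure.haarMeasure (⊤ : TopologicalSpace.PositiveCompacts G)

variable {G H : Type*} [Group G] [TopologicalSpace G] [IsTopologicalGroup G] [CompactSpace G]
  [MeasurableSpace G] [BorelSpace G] [Group H] [TopologicalSpace H] [IsTopologicalGroup H]
  [CompactSpace H] [MeasurableSpace H] [BorelSpace H]

instance haarProb.isProbabilityMeasure : IsProbabilityMeasure (haarProb G) :=
  ⟨Measure.haarMeasure_self⟩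

/-- Compact groups are unimodular: a right translate of the Haar measure is again a left-invariant
probability measure, hence the same one. -/
instance haarProb.isMulRightInvariant : (haarProb G).IsMulRightInvariant where
  map_mul_right_eq_self g := by
    have : IsProbabilityMeasure (Measure.map (· * g) (haarProb G)) :=
      Measure.isProbabilityMeasure_map (measurable_mul_const g).aemeasurable
    exact Measure.isHaarMeasure_eq_of_isProbabilityMeasure _ _

theorem haarProb_map (e : G ≃* H) (he : Continuous e) (he' : Continuous e.symm) :
    Measure.map e (haarProb G) = haarProb H := by
  have : IsProbabilityMeasure (Measure.map e (haarProb G)) :=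
    Measure.isProbabilityMeasure_map he.measurable.aemeasurable
  have := e.isHaarMeasure_map (μ := haarProb G) he he'
  exact Measure.isHaarMeasure_eq_of_isProbabilityMeasure _ _

end HaarProbability

/-! ### Haar measures on Grassmannians as images of group measures -/

section Grassmannian

variable {d j : ℕ} {L : Submodule ℝ (Euc d)}

theorem GrassOver.measurable_starProjection :
    Measurable fun M : GrassOver L j => (M.space.starProjection : Euc d →L[ℝ] Euc d) :=
  comap_measurable _

theorem GrassOver.measurable_iff {α : Type*} [MeasurableSpace α] {f : α → GrassOver L j} :
    Measurable f ↔ Measurable fun a => ((f a).space.starProjection : Euc d →L[ℝ] Euc d) :=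
  measurable_comap_iff

theorem GrassOver.starProjection_injective :
    Function.Injective fun M : GrassOver L j => (M.space.starProjection : Euc d →L[ℝ] Euc d) := by
  rintro ⟨M, hM, _⟩ ⟨N, hN, _⟩ h
  have : M = N := Submodule.starProjection_inj.mp h
  subst this; rfl

/-- Needed to test measurability on the Grassmannian after composing with the surjection g ↦ gM from
the Polish group O(d). -/
instance GrassOver.countablySeparated : MeasurableSpace.CountablySeparated (GrassOver L j) := by
  have : MeasurableSpace.CountablyGenerated (GrassOver L j) :=
    MeasurableSpace.CountablyGenerated.comap _
  have : MeasurableSpace.SeparatesPoints (GrassOver L j) := by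
    rw [MeasurableSpace.separatesPoints_iff]
    intro M N h
    refine GrassOver.starProjection_injective ?_
    by_contra hne
    have := h _ (GrassOver.measurable_starProjection (MeasurableSet.singleton
      (M.space.starProjection : Euc d →L[ℝ] Euc d)))
    exact hne (this.mp rfl).symm
  infer_instance

theorem GrassOver.measurable_rotate (M : GrassOver L j) :
    Measurable fun g : orthStabilizer L => GrassOver.rotate g M :=
  GrassOver.measurable_iff.mpr
    ((OrthGroup.continuous_starProjection_smul M.space).comp continuous_subtype_val).measurable

/-- Conjugation by `g`, as an isomorphism between the stabilizers of `L` and `g(L)`. -/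
def orthStabilizer.conj (g : OrthGroup d) {L' : Submodule ℝ (Euc d)} (hL' : L' = g • L) :
    orthStabilizer L ≃* orthStabilizer L' :=
  MulAction.stabilizerEquivStabilizer hL'

theorem orthStabilizer.coe_conj (g : OrthGroup d) {L' : Submodule ℝ (Euc d)} (hL' : L' = g • L)
    (h : orthStabilizer L) : (orthStabilizer.conj g hL' h : OrthGroup d) = g * h * g⁻¹ :=
  MulAction.stabilizerEquivStabilizer_apply hL' h

theorem orthStabilizer.coe_conj_symm (g : OrthGroup d) {L' : Submodule ℝ (Euc d)}
    (hL' : L' = g • L) (h : orthStabilizer L') :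
    ((orthStabilizer.conj g hL').symm h : OrthGroup d) = g⁻¹ * h * g := by
  refine (MulAction.stabilizerEquivStabilizer_symm_apply hL' h).trans ?_
  rw [MulAut.conj_apply, inv_inv]

theorem orthStabilizer.continuous_conj (g : OrthGroup d) {L' : Submodule ℝ (Euc d)}
    (hL' : L' = g • L) :
    Continuous (orthStabilizer.conj g hL') := by
  refine continuous_induced_rng.mpr ?_
  change Continuous fun h : orthStabilizer L =>
    ((orthStabilizer.conj g hL' h : orthStabilizer L') : OrthGroup d)
  simp only [orthStabilizer.coe_conj]
  fun_prop

/-- Conjugation by `g` transports the Haar measures of stabilizers. -/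
theorem haarProb_orthStabilizer_smul (g : OrthGroup d) {L' : Submodule ℝ (Euc d)}
    (hL' : L' = g • L) :
    Measure.map (orthStabilizer.conj g hL') (haarProb (orthStabilizer L)) =
      haarProb (orthStabilizer L') := by
  refine haarProb_map _ (orthStabilizer.continuous_conj g hL') ?_
  refine continuous_induced_rng.mpr ?_
  change Continuous fun h : orthStabilizer L' =>
    (((orthStabilizer.conj g hL').symm h : orthStabilizer L) : OrthGroup d)
  simp only [orthStabilizer.coe_conj_symm]
  fun_prop

/-- The Haar measure on `G(gL, j)` is the image of the Haar measure on the stabilizer of the line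
`L` under `h ↦ g h M`, for any `M ∈ G(L, j)`. -/
theorem lintegral_grassHaar_smul (g : OrthGroup d) {L' M : Submodule ℝ (Euc d)}
    (hL' : L' = g • L) {x : Euc d} (hL : L = Submodule.span ℝ {x}) (hM : Module.finrank ℝ M = j)
    (hx : x ∈ M) {f : (Euc d →L[ℝ] Euc d) → ENNReal} (hf : Measurable f) :
    ∫⁻ N, f N.space.starProjection ∂(grassHaar L' j) =
      ∫⁻ h : orthStabilizer L, f ((g * (h : OrthGroup d)) • M).starProjection
        ∂(haarProb (orthStabilizer L)) := by
  have hLM : L ≤ M := by rw [hL, Submodule.span_singleton_le_iff_mem]; exact hx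
  have hne : Nonempty (GrassOver L' j) :=
    ⟨⟨g • M, (g.finrank_smul M).trans hM, hL' ▸ Submodule.map_mono hLM⟩⟩
  have hf' : Measurable fun N : GrassOver L' j => f N.space.starProjection :=
    hf.comp GrassOver.measurable_starProjection
  rw [grassHaar, dif_pos hne, lintegral_map hf' (GrassOver.measurable_rotate _)]
  set N := hne.some
  have hxN : x ∈ g⁻¹ • N.space := by
    have h1 : (g : Euc d →L[ℝ] Euc d) x ∈ N.space := by
      apply N.le_space
      rw [hL', hL]
      exact g.apply_mem_smul (Submodule.mem_span_singleton_self x)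
    simpa only [OrthGroup.inv_apply_self] using (g⁻¹).apply_mem_smul h1
  -- The base point N in `grassHaar` is arbitrary. Both M and g⁻¹N contain x, so some k fixing x,
  -- hence preserving L, carries M to g⁻¹N; right invariance on the stabilizer then absorbs k.
  obtain ⟨k, hkx, hkM⟩ := OrthGroup.exists_smul_eq (M := M) (N := g⁻¹ • N.space)
    (by rw [OrthGroup.finrank_smul, N.finrank_eq, hM]) hx hxN
  have hkL : k • L = L := by rw [hL, OrthGroup.smul_span_singleton, hkx]
  have hN : N.space = (g * k) • M := by
    rw [OrthGroup.mul_smul, hkM, ← OrthGroup.mul_smul, mul_inv_cancel]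
    exact (one_smul (OrthGroup d) N.space).symm
  change ∫⁻ h : orthStabilizer L', f ((h : OrthGroup d) • N.space).starProjection
    ∂(haarProb (orthStabilizer L')) = _
  have hmeas : ∀ M' : Submodule ℝ (Euc d),
      Measurable fun h : orthStabilizer L' => f ((h : OrthGroup d) • M').starProjection := fun M' =>
    hf.comp
      ((OrthGroup.continuous_starProjection_smul M').comp continuous_subtype_val).measurable
  have he := (orthStabilizer.continuous_conj g hL').measurable
  rw [← haarProb_orthStabilizer_smul g hL', lintegral_map (hmeas _) he,
    ← lintegral_mul_right_eq_self _ (⟨k, hkL⟩ : orthStabilizer L)⁻¹]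
  refine lintegral_congr fun h => ?_
  rw [hN, ← OrthGroup.mul_smul]
  congr 3
  rw [orthStabilizer.coe_conj]
  simp [mul_assoc]

theorem haarProb_orthStabilizer_bot :
    Measure.map (Subtype.val : orthStabilizer (⊥ : Submodule ℝ (Euc d)) → OrthGroup d)
      (haarProb _) = haarProb (OrthGroup d) := by
  have h : orthStabilizer (⊥ : Submodule ℝ (Euc d)) = ⊤ := by
    rw [eq_top_iff]
    intro g _
    exact Submodule.map_bot _
  refine haarProb_map ((MulEquiv.subgroupCongr h).trans Subgroup.topEquiv) ?_ ?_
  · exact continuous_subtype_val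
  · exact continuous_induced_rng.mpr continuous_id

theorem lintegral_grassHaar_bot (M : Grass d j) {f : (Euc d →L[ℝ] Euc d) → ENNReal}
    (hf : Measurable f) :
    ∫⁻ N, f N.space.starProjection ∂(grassHaar (⊥ : Submodule ℝ (Euc d)) j) =
      ∫⁻ g : OrthGroup d, f (g • M.space).starProjection ∂(haarProb (OrthGroup d)) := by
  have hf' : Measurable fun g : OrthGroup d => f (g • M.space).starProjection :=
    hf.comp (OrthGroup.continuous_starProjection_smul _).measurable
  -- The zero subspace is the span of x = 0, and its stabilizer is all of O(d).
  rw [lintegral_grassHaar_smul 1 (one_smul _ _).symm (Submodule.span_zero_singleton ℝ).symm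
    M.finrank_eq M.space.zero_mem hf, ← haarProb_orthStabilizer_bot,
    lintegral_map hf' measurable_subtype_coe]
  simp only [one_mul]

/-- The rotation `M ↦ g(M)` of the full Grassmannian. -/
def Grass.rotate (g : OrthGroup d) (M : Grass d j) : Grass d j :=
  ⟨g • M.space, (g.finrank_smul _).trans M.finrank_eq, bot_le⟩

theorem Grass.measurable_rotate (M : Grass d j) :
    Measurable fun g : OrthGroup d => Grass.rotate g M :=
  GrassOver.measurable_iff.mpr (OrthGroup.continuous_starProjection_smul M.space).measurable

theorem Grass.rotate_surjective (M : Grass d j) :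
    Function.Surjective fun g : OrthGroup d => Grass.rotate g M := by
  rintro ⟨N, hN, hb⟩
  obtain ⟨g, -, hg⟩ := OrthGroup.exists_smul_eq (M.finrank_eq.trans hN.symm)
    M.space.zero_mem N.zero_mem
  refine ⟨g, ?_⟩
  change GrassOver.mk (g • M.space) _ _ = _
  congr

theorem grassHaar_bot_eq_map (M : Grass d j) :
    grassHaar (⊥ : Submodule ℝ (Euc d)) j =
      Measure.map (fun g : OrthGroup d => Grass.rotate g M) (haarProb (OrthGroup d)) := by
  ext s hs
  obtain ⟨t, ht, rfl⟩ := hs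
  rw [Measure.map_apply (Grass.measurable_rotate M) (GrassOver.measurable_starProjection ht),
    ← lintegral_indicator_one (GrassOver.measurable_starProjection ht),
    ← lintegral_indicator_one (Grass.measurable_rotate M (GrassOver.measurable_starProjection ht))]
  exact lintegral_grassHaar_bot M (f := t.indicator 1) (measurable_one.indicator ht)

end Grassmannian

/-! ### Measurability of projected volumes -/

section Projections

variable {d j : ℕ} {K : Set (Euc d)}

/-- The set is the projection, along the compact factor K, of the closed relation P q = x. This
supplies the joint measurability behind every use of Fubini. -/
theorem isClosed_setOf_mem_image (hK : IsCompact K) :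
    IsClosed {p : Euc d × (Euc d →L[ℝ] Euc d) | p.1 ∈ p.2 '' K} := by
  have : CompactSpace K := isCompact_iff_compactSpace.mp hK
  have h : {p : Euc d × (Euc d →L[ℝ] Euc d) | p.1 ∈ p.2 '' K} =
      Prod.snd '' {q : K × Euc d × (Euc d →L[ℝ] Euc d) | q.2.2 q.1 = q.2.1} := by
    ext ⟨x, P⟩
    simp
  rw [h]
  exact isClosedMap_snd_of_compactSpace _ (isClosed_eq (by fun_prop) (by fun_prop))

/-- Pulling back along g : M → gM replaces a varying measure space by varying subsets of the fixed
space M. -/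
theorem volume_orthogonalProjectionOnto_image_smul (g : OrthGroup d) (M : Submodule ℝ (Euc d)) :
    (volume : Measure (g • M : Submodule ℝ (Euc d)))
        ((g • M).orthogonalProjectionOnto '' K) =
      (volume : Measure M)
        {y | (g : Euc d →L[ℝ] Euc d) y ∈ (g • M).starProjection '' K} := by
  let e : M ≃ₗᵢ[ℝ] (g • M : Submodule ℝ (Euc d)) :=
    (Unitary.linearIsometryEquiv g).submoduleMap M
  rw [← e.measurePreserving.measure_preimage_emb e.toMeasurableEquiv.measurableEmbedding]
  congr 1
  ext y
  have he : ((e y : (g • M : Submodule ℝ (Euc d))) : Euc d) = (g : Euc d →L[ℝ] Euc d) y := rfl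
  simp only [Set.mem_preimage, Set.mem_image, Set.mem_ofPred_eq, ← he, Subtype.ext_iff,
    Submodule.starProjection_apply]

theorem measurable_projVolume (hK : IsCompact K) :
    Measurable fun M : Grass d j => projVolume K M.space := by
  rcases isEmpty_or_nonempty (Grass d j) with h | ⟨⟨M⟩⟩
  · exact measurable_of_empty _
  rw [← (Grass.measurable_rotate M).measurable_comp_iff_of_surjective (Grass.rotate_surjective M)]
  change Measurable fun g : OrthGroup d => ((volume : Measure (g • M.space : Submodule ℝ (Euc d)))
        ((g • M.space).orthogonalProjectionOnto '' K)).toReal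
  simp only [volume_orthogonalProjectionOnto_image_smul]
  refine ENNReal.measurable_toReal.comp
    (measurable_measure_prodMk_left (s := {p : OrthGroup d × M.space |
      ((p.1 : Euc d →L[ℝ] Euc d) p.2, (p.1 • M.space).starProjection) ∈
        {p : Euc d × (Euc d →L[ℝ] Euc d) | p.1 ∈ p.2 '' K}}) ?_)
  refine (isClosed_setOf_mem_image hK).measurableSet.preimage (Continuous.measurable ?_)
  exact (OrthGroup.continuous_apply.comp
    (continuous_fst.prodMk (continuous_subtype_val.comp continuous_snd))).prodMk
    ((OrthGroup.continuous_starProjection_smul M.space).comp continuous_fst)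

end Projections

/-! ### A Blaschke–Petkantschin formula via averages over O(d) -/

section BlaschkePetkantschin

variable {d : ℕ}

/-- The average of `F (g y, gM)` over all rotations `g`. -/
def rotationAverage (M : Submodule ℝ (Euc d)) (F : Euc d × (Euc d →L[ℝ] Euc d) → ENNReal)
    (y : Euc d) : ENNReal :=
  ∫⁻ g : OrthGroup d, F ((g : Euc d →L[ℝ] Euc d) y, (g • M).starProjection)
    ∂(haarProb (OrthGroup d))

/-- The average of `F (x, N)` over all `j`-dimensional subspaces `N` containing `x`. -/
def lineAverage (j : ℕ) (F : Euc d × (Euc d →L[ℝ] Euc d) → ENNReal) (x : Euc d) : ENNReal :=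
  ∫⁻ N, F (x, N.space.starProjection) ∂(grassHaar (Submodule.span ℝ {x}) j)

variable {M : Submodule ℝ (Euc d)} {F : Euc d × (Euc d →L[ℝ] Euc d) → ENNReal}

theorem OrthGroup.continuous_apply_starProjection (M : Submodule ℝ (Euc d)) :
    Continuous fun p : OrthGroup d × Euc d =>
      ((p.1 : Euc d →L[ℝ] Euc d) p.2, (p.1 • M).starProjection) :=
  OrthGroup.continuous_apply.prodMk
    ((OrthGroup.continuous_starProjection_smul M).comp continuous_fst)

theorem measurable_rotationAverage (hF : Measurable F) : Measurable (rotationAverage M F) :=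
  (hF.comp (OrthGroup.continuous_apply_starProjection M).measurable).lintegral_prod_left'

/-- A reflection preserving M carries z to y, and right invariance absorbs it. -/
theorem rotationAverage_eq_of_norm_eq {y z : Euc d} (hy : y ∈ M) (hz : z ∈ M) (h : ‖y‖ = ‖z‖) :
    rotationAverage M F y = rotationAverage M F z := by
  obtain ⟨ρ, hρ, hρM⟩ := OrthGroup.exists_apply_eq h.symm
  rw [rotationAverage, rotationAverage, ← lintegral_mul_right_eq_self
    (fun g : OrthGroup d => F ((g : Euc d →L[ℝ] Euc d) z, (g • M).starProjection)) ρ]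
  refine lintegral_congr fun g => ?_
  rw [OrthGroup.mul_apply, hρ, OrthGroup.smul_mul_starProjection g ρ M (hρM M hz hy)]

theorem lineAverage_apply {j : ℕ} (hF : Measurable F) (hM : Module.finrank ℝ M = j)
    {x y : Euc d} (hx : x ∈ M)
    (hyx : Submodule.span ℝ {y} = Submodule.span ℝ {x}) (g : OrthGroup d) :
    lineAverage j F ((g : Euc d →L[ℝ] Euc d) y) =
      ∫⁻ h : orthStabilizer (Submodule.span ℝ {x}),
        F ((g : Euc d →L[ℝ] Euc d) y, ((g * (h : OrthGroup d)) • M).starProjection)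
          ∂(haarProb (orthStabilizer (Submodule.span ℝ {x}))) :=
  lintegral_grassHaar_smul g (by rw [← OrthGroup.smul_span_singleton, hyx]) rfl hM hx
    (f := fun P => F ((g : Euc d →L[ℝ] Euc d) y, P)) (hF.comp measurable_prodMk_left)

theorem measurable_apply_smul_mul {L : Submodule ℝ (Euc d)} (hF : Measurable F) {α : Type*}
    [MeasurableSpace α] {u : α → Euc d} (hu : Measurable u) {v : α → OrthGroup d}
    (hv : Measurable v) :
    Measurable fun p : α × orthStabilizer L =>
      F ((v p.1 : Euc d →L[ℝ] Euc d) (u p.1), ((v p.1 * (p.2 : OrthGroup d)) • M).starProjection) := by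
  refine hF.comp (Measurable.prodMk ?_ ?_)
  · exact OrthGroup.continuous_apply.measurable.comp
      ((hv.comp measurable_fst).prodMk (hu.comp measurable_fst))
  · exact (OrthGroup.continuous_starProjection_smul M).measurable.comp
      ((hv.comp measurable_fst).mul (measurable_subtype_coe.comp measurable_snd))

/-- Averaging over the subspaces through gx is averaging over ghM with h in the stabilizer of the
line of x. After swapping the integrals, g ↦ gh⁻¹ moves h from the subspace to the point h⁻¹x, which
still lies in M and has norm ‖x‖, so h no longer matters. -/
theorem lintegral_lineAverage {j : ℕ} (hF : Measurable F) (hM : Module.finrank ℝ M = j)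
    {x y : Euc d} (hx : x ∈ M) (hxy : ‖y‖ = ‖x‖) :
    ∫⁻ g : OrthGroup d, lineAverage j F ((g : Euc d →L[ℝ] Euc d) y) ∂(haarProb (OrthGroup d)) =
      rotationAverage M F x := by
  obtain ⟨ρ, hρ, -⟩ := OrthGroup.exists_apply_eq hxy.symm
  have hstab : ∀ h : orthStabilizer (Submodule.span ℝ {x}),
      (((h : OrthGroup d)⁻¹ : OrthGroup d) : Euc d →L[ℝ] Euc d) x ∈ M := by
    intro h
    have h1 := (h⁻¹).2
    rw [MulAction.mem_stabilizer_iff, OrthGroup.smul_eq_iff] at h1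
    have h2 := h1 x (Submodule.mem_span_singleton_self x)
    exact (Submodule.span_singleton_le_iff_mem _ _).mpr hx h2
  calc ∫⁻ g : OrthGroup d, lineAverage j F ((g : Euc d →L[ℝ] Euc d) y) ∂(haarProb (OrthGroup d))
      = ∫⁻ g : OrthGroup d, lineAverage j F ((g : Euc d →L[ℝ] Euc d) x)
          ∂(haarProb (OrthGroup d)) := by
        rw [← lintegral_mul_right_eq_self
          (fun g : OrthGroup d => lineAverage j F ((g : Euc d →L[ℝ] Euc d) y)) ρ⁻¹]
        simp only [OrthGroup.mul_apply, ← hρ, OrthGroup.inv_apply_self]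
    _ = ∫⁻ g : OrthGroup d, ∫⁻ h : orthStabilizer (Submodule.span ℝ {x}),
          F ((g : Euc d →L[ℝ] Euc d) x, ((g * (h : OrthGroup d)) • M).starProjection)
            ∂(haarProb (orthStabilizer (Submodule.span ℝ {x}))) ∂(haarProb (OrthGroup d)) :=
        lintegral_congr fun g =>
          lineAverage_apply hF hM hx rfl g
    _ = ∫⁻ h : orthStabilizer (Submodule.span ℝ {x}), ∫⁻ g : OrthGroup d,
          F ((g : Euc d →L[ℝ] Euc d) x, ((g * (h : OrthGroup d)) • M).starProjection)
            ∂(haarProb (OrthGroup d)) ∂(haarProb (orthStabilizer (Submodule.span ℝ {x}))) :=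
        lintegral_lintegral_swap
          (measurable_apply_smul_mul hF measurable_const measurable_id).aemeasurable
    _ = ∫⁻ _ : orthStabilizer (Submodule.span ℝ {x}), rotationAverage M F x
          ∂(haarProb (orthStabilizer (Submodule.span ℝ {x}))) := by
        refine lintegral_congr fun h => ?_
        rw [← rotationAverage_eq_of_norm_eq (hstab h) hx (OrthGroup.norm_apply _ _),
          rotationAverage, ← lintegral_mul_right_eq_self
          (fun g : OrthGroup d => F ((g : Euc d →L[ℝ] Euc d)
            ((((h : OrthGroup d)⁻¹ : OrthGroup d) : Euc d →L[ℝ] Euc d) x),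
              (g • M).starProjection)) (h : OrthGroup d)]
        simp only [OrthGroup.mul_apply, OrthGroup.self_apply_inv]
    _ = rotationAverage M F x := by simp

/-- Here the measure and its space vary with x. Writing x = g(re) with (r, g) in the Polish space ℝ
× O(d) turns the average into an integral over one fixed stabilizer, except at r = 0, where the line
degenerates. -/
theorem measurable_lineAverage {j : ℕ} (hF : Measurable F) (hM : Module.finrank ℝ M = j)
    {e : Euc d} (he : e ∈ M) (hne : ‖e‖ = 1) : Measurable (lineAverage j F) := by
  let p : ℝ × OrthGroup d → Euc d := fun q => (q.2 : Euc d →L[ℝ] Euc d) (q.1 • e)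
  have hp : Measurable p := OrthGroup.continuous_apply.measurable.comp
    (measurable_snd.prodMk (measurable_fst.smul_const e))
  have hsurj : Function.Surjective p := by
    intro x
    obtain ⟨g, hg, -⟩ := OrthGroup.exists_apply_eq (v := ‖x‖ • e) (w := x)
      (by rw [norm_smul, hne, mul_one, norm_norm])
    exact ⟨(‖x‖, g), hg⟩
  rw [← hp.measurable_comp_iff_of_surjective hsurj]
  have key : lineAverage j F ∘ p = fun q => if q.1 = 0 then lineAverage j F 0 else
      ∫⁻ h : orthStabilizer (Submodule.span ℝ {e}),
        F ((q.2 : Euc d →L[ℝ] Euc d) (q.1 • e),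
          ((q.2 * (h : OrthGroup d)) • M).starProjection)
          ∂(haarProb (orthStabilizer (Submodule.span ℝ {e}))) := by
    ext ⟨r, g⟩
    by_cases hr : r = 0
    · simp [hr, p]
    · simp only [hr, if_false]
      exact lineAverage_apply hF hM he
        (Submodule.span_singleton_smul_eq (IsUnit.mk0 r hr) e) g
  rw [key]
  refine Measurable.ite (measurable_fst (measurableSet_singleton 0)) measurable_const ?_
  exact (measurable_apply_smul_mul hF (measurable_fst.smul_const e)
    measurable_snd).lintegral_prod_right'

theorem OrthGroup.lintegral_comp (g : OrthGroup d) (f : Euc d → ENNReal) :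
    ∫⁻ x, f ((g : Euc d →L[ℝ] Euc d) x) = ∫⁻ x, f x :=
  (Unitary.linearIsometryEquiv g).measurePreserving.lintegral_comp_emb
    (Unitary.linearIsometryEquiv g).toMeasurableEquiv.measurableEmbedding f

/-- The left side does not change when the argument of the average is rotated by g, so it may be
averaged over g. -/
theorem lintegral_mul_lineAverage {j : ℕ} (hF : Measurable F) (hM : Module.finrank ℝ M = j)
    {e : Euc d} (he : e ∈ M) (hne : ‖e‖ = 1) {w : ℝ → ENNReal} (hw : Measurable w) :
    ∫⁻ x, w ‖x‖ * lineAverage j F x = ∫⁻ x : Euc d, w ‖x‖ * rotationAverage M F (‖x‖ • e) := by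
  have hm := measurable_lineAverage hF hM he hne
  calc ∫⁻ x, w ‖x‖ * lineAverage j F x
      = ∫⁻ g : OrthGroup d, ∫⁻ x : Euc d,
          w ‖x‖ * lineAverage j F ((g : Euc d →L[ℝ] Euc d) x) ∂volume ∂(haarProb (OrthGroup d)) := by
        have : ∀ g : OrthGroup d, ∫⁻ x : Euc d,
            w ‖x‖ * lineAverage j F ((g : Euc d →L[ℝ] Euc d) x) =
              ∫⁻ x, w ‖x‖ * lineAverage j F x := by
          intro g
          rw [← g.lintegral_comp (fun x => w ‖x‖ * lineAverage j F x)]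
          simp only [OrthGroup.norm_apply]
        simp [this]
    _ = ∫⁻ x : Euc d, ∫⁻ g : OrthGroup d,
          w ‖x‖ * lineAverage j F ((g : Euc d →L[ℝ] Euc d) x) ∂(haarProb (OrthGroup d)) :=
        lintegral_lintegral_swap (((hw.comp measurable_norm).comp measurable_snd).mul
          (hm.comp OrthGroup.continuous_apply.measurable)).aemeasurable
    _ = ∫⁻ x : Euc d, w ‖x‖ * rotationAverage M F (‖x‖ • e) := by
        refine lintegral_congr fun x => ?_
        rw [lintegral_const_mul, lintegral_lineAverage hF hM (M.smul_mem _ he)]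
        · rw [norm_smul, hne, mul_one, norm_norm]
        · exact hm.comp (OrthGroup.continuous_apply.measurable.comp measurable_prodMk_right)

theorem lintegral_lintegral_smul (hF : Measurable F) {e : Euc d} (he : e ∈ M) (hne : ‖e‖ = 1) :
    ∫⁻ g : OrthGroup d, ∫⁻ y : M, F ((g : Euc d →L[ℝ] Euc d) y, (g • M).starProjection)
        ∂volume ∂(haarProb (OrthGroup d)) = ∫⁻ y : M, rotationAverage M F (‖y‖ • e) := by
  rw [lintegral_lintegral_swap]
  · refine lintegral_congr fun y => ?_
    refine rotationAverage_eq_of_norm_eq y.2 (M.smul_mem _ he) ?_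
    rw [norm_smul, hne, mul_one, norm_norm, Submodule.coe_norm]
  · exact (hF.comp ((OrthGroup.continuous_apply_starProjection M).measurable.comp
      (measurable_fst.prodMk (measurable_subtype_coe.comp measurable_snd)))).aemeasurable

end BlaschkePetkantschin

/-! ### Polar coordinates in M and in ℝᵈ -/

section Radial

variable {d j : ℕ}

theorem kappa_pos (k : ℕ) : 0 < kappa k :=
  ENNReal.toReal_pos (Metric.measure_closedBall_pos _ _ one_pos).ne'
    measure_closedBall_lt_top.ne

theorem volume_real_closedBall_submodule {M : Submodule ℝ (Euc d)}
    (hM : Module.finrank ℝ M = j) :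
    (volume : Measure M).real (Metric.closedBall 0 1) = kappa j := by
  subst hM
  have h := (stdOrthonormalBasis ℝ M).repr.measurePreserving.measure_preimage_emb
    (stdOrthonormalBasis ℝ M).repr.toMeasurableEquiv.measurableEmbedding (Metric.closedBall 0 1)
  rw [kappa, Measure.real, Measure.real, ← h]
  congr 2
  ext y
  simp

theorem integral_fun_norm_submodule {M : Submodule ℝ (Euc d)} (hM : Module.finrank ℝ M = j)
    (hj : 1 ≤ j) (f : ℝ → ℝ) :
    ∫ y : M, f ‖y‖ = j * kappa j * ∫ r in Set.Ioi (0 : ℝ), r ^ (j - 1) * f r := by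
  have : Nontrivial M := Module.nontrivial_of_finrank_pos (R := ℝ) (by omega)
  rw [integral_fun_norm_addHaar, hM, ← volume_real_closedBall_submodule hM, Measure.real,
    Measure.real, Measure.addHaar_closedBall_eq_addHaar_ball]
  simp [mul_assoc]

theorem integral_fun_norm_euc (hd : 1 ≤ d) (f : ℝ → ℝ) :
    ∫ y : Euc d, f ‖y‖ = d * kappa d * ∫ r in Set.Ioi (0 : ℝ), r ^ (d - 1) * f r := by
  have : Nontrivial (Euc d) := Module.nontrivial_of_finrank_pos (R := ℝ) (by simp; omega)
  rw [integral_fun_norm_addHaar, finrank_euclideanSpace_fin, kappa, Measure.real, Measure.real,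
    Measure.addHaar_closedBall_eq_addHaar_ball]
  simp [mul_assoc]

theorem pow_mul_zpow_sub (hj : 1 ≤ j) (hjd : j ≤ d) {r : ℝ} (hr : 0 < r) (a : ℝ) :
    r ^ (d - 1) * (r ^ (-((d : ℤ) - (j : ℤ))) * a) = r ^ (j - 1) * a := by
  rw [← mul_assoc, ← zpow_natCast, ← zpow_natCast, ← zpow_add₀ hr.ne']
  congr 2
  omega

theorem integrable_zpow_mul_norm {M : Submodule ℝ (Euc d)} (hM : Module.finrank ℝ M = j)
    (hj : 1 ≤ j) (hjd : j ≤ d) {f : ℝ → ℝ} (hf : Integrable fun y : M => f ‖y‖) :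
    Integrable fun x : Euc d => ‖x‖ ^ (-((d : ℤ) - (j : ℤ))) * f ‖x‖ := by
  have : Nontrivial M := Module.nontrivial_of_finrank_pos (R := ℝ) (by omega)
  have : Nontrivial (Euc d) := Module.nontrivial_of_finrank_pos (R := ℝ) (by simp; omega)
  rw [integrable_fun_norm_addHaar, hM] at hf
  rw [integrable_fun_norm_addHaar volume (f := fun r => r ^ (-((d : ℤ) - (j : ℤ))) * f r),
    finrank_euclideanSpace_fin]
  refine hf.congr_fun (fun r hr => ?_) measurableSet_Ioi
  exact (pow_mul_zpow_sub hj hjd hr _).symm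

/-- The weight changes the radial density r^{d-1} of ℝᵈ into the density r^{j-1} of M; the
prefactors are the sphere areas jκ_j and dκ_d. -/
theorem integral_zpow_mul_norm {M : Submodule ℝ (Euc d)} (hM : Module.finrank ℝ M = j)
    (hj : 1 ≤ j) (hjd : j ≤ d) (f : ℝ → ℝ) :
    j * kappa j * ∫ x : Euc d, ‖x‖ ^ (-((d : ℤ) - (j : ℤ))) * f ‖x‖ =
      d * kappa d * ∫ y : M, f ‖y‖ := by
  rw [integral_fun_norm_submodule hM hj,
    integral_fun_norm_euc (hj.trans hjd) (fun r => r ^ (-((d : ℤ) - (j : ℤ))) * f r),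
    setIntegral_congr_fun measurableSet_Ioi fun r hr => pow_mul_zpow_sub hj hjd hr (f r)]
  ring

end Radial

/-! ### Missed points, finiteness and the constant -/

section Assembly

variable {d j : ℕ} {K : Set (Euc d)}

/-- The pairs `(x, P)` such that `x` lies in the unit ball but not in `P(K)`. -/
def missedPairs (K : Set (Euc d)) : Set (Euc d × (Euc d →L[ℝ] Euc d)) :=
  {p | ‖p.1‖ ≤ 1 ∧ p.1 ∉ p.2 '' K}

theorem measurableSet_missedPairs (hK : IsCompact K) : MeasurableSet (missedPairs K) :=
  (measurableSet_le (measurable_norm.comp measurable_fst) measurable_const).inter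
    (isClosed_setOf_mem_image hK).measurableSet.compl

theorem measurable_indicator_missedPairs (hK : IsCompact K) :
    Measurable ((missedPairs K).indicator (1 : Euc d × (Euc d →L[ℝ] Euc d) → ENNReal)) :=
  measurable_one.indicator (measurableSet_missedPairs hK)

theorem starProjection_image_subset_closedBall (hKB : K ⊆ Metric.closedBall 0 1)
    (M : Submodule ℝ (Euc d)) : M.starProjection '' K ⊆ Metric.closedBall 0 1 := by
  rintro _ ⟨x, hx, rfl⟩
  rw [mem_closedBall_zero_iff]
  exact (M.norm_starProjection_apply_le x).trans (mem_closedBall_zero_iff.mp (hKB hx))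

theorem theta_eq_toReal_lineAverage (hK : IsCompact K) {x : Euc d} (hx : ‖x‖ ≤ 1) :
    theta j K x = (lineAverage j ((missedPairs K).indicator 1) x).toReal := by
  have hm := (measurableSet_missedPairs hK).preimage
    (measurable_prodMk_left (x := x) : Measurable fun P : Euc d →L[ℝ] Euc d => (x, P))
  have := lintegral_indicator_one (μ := grassHaar (Submodule.span ℝ {x}) j)
    (GrassOver.measurable_starProjection hm)
  rw [theta, Measure.real, lineAverage]
  congr 1
  refine Eq.trans ?_ this.symm
  congr 1
  ext N
  simp [missedPairs, hx]

theorem lineAverage_eq_zero_of_one_lt {x : Euc d} (hx : 1 < ‖x‖) :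
    lineAverage j ((missedPairs K).indicator 1) x = 0 := by
  simp [lineAverage, missedPairs, hx.not_ge]

/-- A point x ∈ K lying in N is its own projection, so no N through x misses it. Hence the integral
over 𝔹 \ K extends to the whole space. -/
theorem lineAverage_eq_zero_of_mem {x : Euc d} (hx : x ∈ K) :
    lineAverage j ((missedPairs K).indicator 1) x = 0 := by
  rw [lineAverage]
  refine (lintegral_congr fun N => ?_).trans lintegral_zero
  refine Set.indicator_of_notMem (fun h => h.2 ⟨x, hx, ?_⟩) _
  exact Submodule.starProjection_eq_self_iff.mpr
    (N.le_space (Submodule.mem_span_singleton_self x))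

theorem indicator_theta_mul (hK : IsCompact K) (w : ℝ → ℝ) (hw : ∀ r, 0 ≤ r → 0 ≤ w r) :
    (Metric.closedBall 0 1 \ K).indicator (fun x => theta j K x * w ‖x‖) =
      fun x => (ENNReal.ofReal (w ‖x‖) *
        lineAverage j ((missedPairs K).indicator 1) x).toReal := by
  ext x
  rw [ENNReal.toReal_mul, ENNReal.toReal_ofReal (hw _ (norm_nonneg x))]
  by_cases hx : x ∈ Metric.closedBall 0 1 \ K
  · rw [Set.indicator_of_mem hx, theta_eq_toReal_lineAverage hK (mem_closedBall_zero_iff.mp hx.1),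
      mul_comm]
  · rw [Set.indicator_of_notMem hx]
    by_cases hxB : x ∈ Metric.closedBall 0 1
    · rw [lineAverage_eq_zero_of_mem (by by_contra h; exact hx ⟨hxB, h⟩)]; simp
    · rw [lineAverage_eq_zero_of_one_lt (by simpa using hxB)]; simp

theorem rotationAverage_missedPairs_le (M : Submodule ℝ (Euc d)) (x : Euc d) :
    rotationAverage M ((missedPairs K).indicator 1) x ≤ (Metric.closedBall 0 1).indicator 1 x := by
  by_cases hx : ‖x‖ ≤ 1
  · rw [Set.indicator_of_mem (mem_closedBall_zero_iff.mpr hx), rotationAverage]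
    refine (lintegral_mono fun g => Set.indicator_le_self' (by simp) _).trans ?_
    simp
  · simp [rotationAverage, missedPairs, hx, OrthGroup.norm_apply]

theorem projVolume_smul (g : OrthGroup d) (M : Submodule ℝ (Euc d)) :
    projVolume K (g • M) = (volume : Measure M).real
      {y | (g : Euc d →L[ℝ] Euc d) y ∈ (g • M).starProjection '' K} :=
  congrArg ENNReal.toReal (volume_orthogonalProjectionOnto_image_smul g M)

theorem setOf_mem_image_subset_closedBall (hKB : K ⊆ Metric.closedBall 0 1) (g : OrthGroup d)
    (M : Submodule ℝ (Euc d)) :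
    {y : M | (g : Euc d →L[ℝ] Euc d) y ∈ (g • M).starProjection '' K} ⊆
      Metric.closedBall 0 1 := by
  intro y hy
  have := starProjection_image_subset_closedBall hKB _ hy
  rwa [mem_closedBall_zero_iff, OrthGroup.norm_apply, ← Submodule.coe_norm,
    ← mem_closedBall_zero_iff] at this

theorem setOf_mem_image_closedBall (g : OrthGroup d) (M : Submodule ℝ (Euc d)) :
    {y : M | (g : Euc d →L[ℝ] Euc d) y ∈ (g • M).starProjection '' Metric.closedBall 0 1} =
      Metric.closedBall 0 1 := by
  refine (setOf_mem_image_subset_closedBall subset_rfl g M).antisymm fun y hy => ?_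
  refine ⟨(g : Euc d →L[ℝ] Euc d) y, ?_,
    Submodule.starProjection_eq_self_iff.mpr (g.apply_mem_smul y.2)⟩
  rwa [mem_closedBall_zero_iff, OrthGroup.norm_apply, ← Submodule.coe_norm,
    ← mem_closedBall_zero_iff]

theorem projVolume_sub_projVolume (hK : IsCompact K) (hKB : K ⊆ Metric.closedBall 0 1)
    (g : OrthGroup d) (M : Submodule ℝ (Euc d)) :
    projVolume (Metric.closedBall 0 1) (g • M) - projVolume K (g • M) =
      (∫⁻ y : M, (missedPairs K).indicator 1
        ((g : Euc d →L[ℝ] Euc d) y, (g • M).starProjection)).toReal := by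
  have hc : Continuous fun y : M =>
      ((g : Euc d →L[ℝ] Euc d) y, (g • M).starProjection) := by fun_prop
  have hm : MeasurableSet {y : M | (g : Euc d →L[ℝ] Euc d) y ∈ (g • M).starProjection '' K} :=
    (isClosed_setOf_mem_image hK).measurableSet.preimage hc.measurable
  have h := lintegral_indicator_one (μ := (volume : Measure M))
    ((measurableSet_missedPairs hK).preimage hc.measurable)
  rw [projVolume_smul, projVolume_smul, setOf_mem_image_closedBall,
    ← measureReal_sdiff (setOf_mem_image_subset_closedBall hKB g M) hm
      measure_closedBall_lt_top.ne]
  refine congrArg ENNReal.toReal (Eq.trans ?_ h.symm)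
  congr 1
  ext y
  simp [missedPairs, OrthGroup.norm_apply]

theorem projVolume_smul_le (hKB : K ⊆ Metric.closedBall 0 1)
    (g : OrthGroup d) (M : Submodule ℝ (Euc d)) :
    projVolume K (g • M) ≤ (volume : Measure M).real (Metric.closedBall 0 1) := by
  rw [projVolume_smul]
  exact measureReal_mono (setOf_mem_image_subset_closedBall hKB g M) measure_closedBall_lt_top.ne

theorem integrable_projVolume (hK : IsCompact K) (hKB : K ⊆ Metric.closedBall 0 1)
    (M : Grass d j) :
    Integrable (fun g : OrthGroup d => projVolume K (g • M.space)) (haarProb (OrthGroup d)) := by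
  refine Integrable.of_bound
    ((measurable_projVolume hK).comp (Grass.measurable_rotate M)).aestronglyMeasurable
    ((volume : Measure M.space).real (Metric.closedBall 0 1)) (Filter.Eventually.of_forall fun g => ?_)
  rw [projVolume, Real.norm_of_nonneg measureReal_nonneg]
  exact projVolume_smul_le hKB g M.space

theorem integral_projVolume_sub (hK : IsCompact K) (hKB : K ⊆ Metric.closedBall 0 1)
    (M : Grass d j) {e : Euc d} (he : e ∈ M.space) (hne : ‖e‖ = 1) :
    ∫ N : Grass d j, projVolume (Metric.closedBall 0 1) N.space
        ∂(grassHaar (⊥ : Submodule ℝ (Euc d)) j) -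
      ∫ N : Grass d j, projVolume K N.space ∂(grassHaar (⊥ : Submodule ℝ (Euc d)) j) =
    ∫ y : M.space, (rotationAverage M.space ((missedPairs K).indicator 1) (‖y‖ • e)).toReal := by
  set F := (missedPairs K).indicator (1 : Euc d × (Euc d →L[ℝ] Euc d) → ENNReal) with hFdef
  have hF : Measurable F := measurable_indicator_missedPairs hK
  have hB : IsCompact (Metric.closedBall (0 : Euc d) 1) := isCompact_closedBall 0 1
  have hmF : Measurable fun p : OrthGroup d × M.space =>
      F ((p.1 : Euc d →L[ℝ] Euc d) p.2, (p.1 • M.space).starProjection) :=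
    hF.comp ((OrthGroup.continuous_apply_starProjection M.space).measurable.comp
      (measurable_fst.prodMk (measurable_subtype_coe.comp measurable_snd)))
  rw [grassHaar_bot_eq_map M,
    integral_map (Grass.measurable_rotate M).aemeasurable
      (measurable_projVolume hB).aestronglyMeasurable,
    integral_map (Grass.measurable_rotate M).aemeasurable
      (measurable_projVolume hK).aestronglyMeasurable]
  simp only [Grass.rotate]
  rw [← integral_sub (integrable_projVolume hB subset_rfl M) (integrable_projVolume hK hKB M)]
  simp only [projVolume_sub_projVolume hK hKB]
  rw [integral_toReal hmF.lintegral_prod_right'.aemeasurable,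
    lintegral_lintegral_smul hF he hne, integral_toReal]
  · exact ((measurable_rotationAverage hF).comp
      (measurable_norm.smul_const e)).aemeasurable
  · refine Filter.Eventually.of_forall fun y => ?_
    exact (rotationAverage_missedPairs_le _ _).trans_lt
      ((Set.indicator_le_self' (by simp) _).trans_lt ENNReal.one_lt_top)
  -- Finiteness: the integrand is at most the indicator of the unit ball of M.
  · refine Filter.Eventually.of_forall fun g => ?_
    refine lt_of_le_of_lt ?_ (measure_closedBall_lt_top (μ := (volume : Measure M.space))
      (x := 0) (r := 1))
    rw [← lintegral_indicator_one measurableSet_closedBall]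
    refine lintegral_mono fun y => ?_
    by_cases hy : ‖y‖ ≤ 1
    · rw [Set.indicator_of_mem (mem_closedBall_zero_iff.mpr hy)]
      exact Set.indicator_le_self' (by simp) _
    · simp [hFdef, missedPairs, OrthGroup.norm_apply, ← Submodule.coe_norm, hy]

theorem integrable_rotationAverage_norm (hK : IsCompact K) {M : Submodule ℝ (Euc d)} {e : Euc d}
    (hne : ‖e‖ = 1) :
    Integrable fun y : M =>
      (rotationAverage M ((missedPairs K).indicator 1) (‖y‖ • e)).toReal := by
  refine integrable_toReal_of_lintegral_ne_top
    ((measurable_rotationAverage (measurable_indicator_missedPairs hK)).comp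
      (measurable_norm.smul_const e)).aemeasurable (ne_of_lt ?_)
  refine lt_of_le_of_lt ?_ (measure_closedBall_lt_top (μ := (volume : Measure M))
    (x := 0) (r := 1))
  rw [← lintegral_indicator_one measurableSet_closedBall]
  refine lintegral_mono fun y => (rotationAverage_missedPairs_le _ _).trans (le_of_eq ?_)
  simp [Set.indicator, norm_smul, hne]

theorem nonempty_grass (hjd : j ≤ d) : Nonempty (Grass d j) := by
  obtain ⟨v, hv⟩ := exists_linearIndependent_of_le_finrank (R := ℝ) (M := Euc d)
    (hjd.trans_eq finrank_euclideanSpace_fin.symm)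
  exact ⟨⟨Submodule.span ℝ (Set.range v), by simpa using finrank_span_eq_card hv, bot_le⟩⟩

/-- Yields at once the finiteness behind integrability and the value of the integral. -/
theorem lintegral_theta_kernel (hK : IsCompact K) {M : Submodule ℝ (Euc d)}
    (hM : Module.finrank ℝ M = j) {e : Euc d} (he : e ∈ M) (hne : ‖e‖ = 1) {w : ℝ → ℝ}
    (hw : Measurable w) (hw0 : ∀ r, 0 ≤ r → 0 ≤ w r)
    (hint : Integrable fun x : Euc d => w ‖x‖ *
      (rotationAverage M ((missedPairs K).indicator 1) (‖x‖ • e)).toReal) :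
    ∫⁻ x : Euc d, ENNReal.ofReal (w ‖x‖) * lineAverage j ((missedPairs K).indicator 1) x =
      ENNReal.ofReal (∫ x : Euc d, w ‖x‖ *
        (rotationAverage M ((missedPairs K).indicator 1) (‖x‖ • e)).toReal) := by
  rw [lintegral_mul_lineAverage (w := fun r => ENNReal.ofReal (w r))
      (measurable_indicator_missedPairs hK) hM he hne hw.ennreal_ofReal,
    ofReal_integral_eq_lintegral_ofReal hint
      (Filter.Eventually.of_forall fun x =>
        mul_nonneg (hw0 _ (norm_nonneg x)) ENNReal.toReal_nonneg)]
  refine lintegral_congr fun x => ?_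
  rw [ENNReal.ofReal_mul (hw0 _ (norm_nonneg x)), ENNReal.ofReal_toReal]
  exact ((rotationAverage_missedPairs_le _ _).trans_lt
      ((Set.indicator_le_self' (by simp) _).trans_lt ENNReal.one_lt_top)).ne

theorem choose_mul_kappa (hj : 1 ≤ j) (hjd : j ≤ d) {A B : ℝ}
    (h : j * kappa j * B = d * kappa d * A) :
    (d.choose j : ℝ) * (kappa d / (kappa j * kappa (d - j))) * A =
      ((d - 1).choose (j - 1) : ℝ) / kappa (d - j) * B := by
  obtain ⟨i, rfl⟩ := Nat.exists_eq_add_of_le' hj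
  obtain ⟨m, rfl⟩ := Nat.exists_eq_add_of_le' (hj.trans hjd)
  have hc : ((m + 1 : ℕ) : ℝ) * (m.choose i : ℝ) =
      ((m + 1).choose (i + 1) : ℝ) * ((i + 1 : ℕ) : ℝ) := by
    exact_mod_cast Nat.add_one_mul_choose_eq m i
  have h1 := (kappa_pos (i + 1)).ne'
  have h2 := (kappa_pos (m + 1 - (i + 1))).ne'
  have h3 : ((m + 1 : ℕ) : ℝ) ≠ 0 := by positivity
  rw [Nat.add_sub_cancel, Nat.add_sub_cancel]
  field_simp
  -- The factor d makes both `h` and d·C(d-1, j-1) = j·C(d, j) applicable.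
  refine mul_left_cancel₀ h3 ?_
  linear_combination (-(((m + 1).choose (i + 1) : ℝ))) * h - kappa (i + 1) * B * hc

end Assembly

end

theorem lemmaA1 (d j : ℕ) (hj : 1 ≤ j) (hjd : j ≤ d - 1)
    (K : Set (Euc d)) (hKc : IsCompact K) (hKconv : Convex ℝ K) (hKint : (interior K).Nonempty)
    (hKB : K ⊆ Metric.closedBall 0 1) :
    IntegrableOn (fun x : Euc d => theta j K x * ‖x‖ ^ (-((d : ℤ) - (j : ℤ))))
        (Metric.closedBall 0 1 \ K) volume ∧
      intrinsicVolume j (Metric.closedBall (0 : Euc d) 1) - intrinsicVolume j K =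
        ((d - 1).choose (j - 1) : ℝ) / kappa (d - j) *
          ∫ x in Metric.closedBall (0 : Euc d) 1 \ K,
            theta j K x * ‖x‖ ^ (-((d : ℤ) - (j : ℤ))) := by
  have hjd' : j ≤ d := hjd.trans (Nat.sub_le d 1)
  obtain ⟨M⟩ := nonempty_grass hjd'
  have : Nontrivial M.space :=
    Module.nontrivial_of_finrank_pos (R := ℝ) (by rw [M.finrank_eq]; omega)
  -- A unit vector of M exists because j ≥ 1.
  obtain ⟨⟨e, he⟩, hne⟩ := exists_norm_eq M.space zero_le_one
  rw [Submodule.coe_norm] at hne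
  set w : ℝ → ℝ := fun r => r ^ (-((d : ℤ) - (j : ℤ))) with hwdef
  have hw : Measurable w := by fun_prop
  have hw0 : ∀ r, 0 ≤ r → 0 ≤ w r := fun r hr => zpow_nonneg hr _
  have hind := indicator_theta_mul (j := j) hKc w hw0
  have hint := integrable_zpow_mul_norm M.finrank_eq hj hjd'
    (f := fun r => (rotationAverage M.space ((missedPairs K).indicator 1) (r • e)).toReal)
    (integrable_rotationAverage_norm hKc hne)
  have hker := lintegral_theta_kernel hKc M.finrank_eq he hne hw hw0 hint
  have hmeas : Measurable fun x : Euc d =>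
      ENNReal.ofReal (w ‖x‖) * lineAverage j ((missedPairs K).indicator 1) x :=
    (hw.comp measurable_norm).ennreal_ofReal.mul
      (measurable_lineAverage (measurable_indicator_missedPairs hKc) M.finrank_eq he hne)
  have hfin := (ENNReal.ofReal_ne_top.symm.trans_eq hker.symm).symm
  have hS : MeasurableSet (Metric.closedBall (0 : Euc d) 1 \ K) :=
    measurableSet_closedBall.diff hKc.measurableSet
  refine ⟨?_, ?_⟩
  · rw [← integrable_indicator_iff hS, hind]
    exact integrable_toReal_of_lintegral_ne_top hmeas.aemeasurable hfin
  · rw [← integral_indicator hS, hind, integral_toReal hmeas.aemeasurable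
      (ae_lt_top hmeas hfin), hker, ENNReal.toReal_ofReal, intrinsicVolume, intrinsicVolume,
      ← mul_sub, integral_projVolume_sub hKc hKB M he hne]
    · exact choose_mul_kappa hj hjd' (integral_zpow_mul_norm M.finrank_eq hj hjd'
        fun r => (rotationAverage M.space ((missedPairs K).indicator 1) (r • e)).toReal)
    · exact integral_nonneg fun x => mul_nonneg (hw0 _ (norm_nonneg x)) ENNReal.toReal_nonneg
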